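/- Let $F$ be a field of characteristic zero, let $m\ge 1$, and let $R=UT_{2m}(F)$ be the algebra of upper triangular $2m\times 2m$ matrices over $F$, with matrix units $e_{ij}$. Let $\ast$ be either the orthogonal involution $\circ$ of $R$, the linear map with $e_{ij}^{\circ}=e_{2m+1-j,\,2m+1-i}$, or the symplectic involution $X\mapsto DX^{\circ}D^{-1}$, where $D=\mathrm{diag}(1,\dots,1,-1,\dots,-1)$ with $m$ entries $1$ followed by $m$ entries $-1$. Let $L=S(2m)$ be the Lie superalgebra $$L=\left\{\begin{pmatrix} x & y\\ z & -x^{\ast}\end{pmatrix} : x,y,z\in R,\ y^{\ast}=y,\ z^{\ast}=-z\right\}\subseteq M_2(R),$$ whose even part $L_0$ consists of the elements with $y=z=0$ and whose odd part $L_1$ consists of the elements with $x=0$, with product the bilinear extension of $[a,b]=ab-(-1)^{|a||b|}ba$ for homogeneous $a,b$. For $k,r\ge 0$ let $P_{k,r}$ be the space of multilinear polynomials in even variables $x_1,\dots,x_k$ and odd variables $y_1,\dots,y_r$ in the absolutely free nonassociative $F$-algebra $F\{X,Y\}$. Let $\mathrm{Id}^{gr}(L)$ be the set of graded identities of $L$,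 that is, of all $f\in F\{X,Y\}$ that vanish whenever the even variables are replaced by elements of $L_0$ and the odd variables by elements of $L_1$. Put $$c_{k,r}(L)=\dim \frac{P_{k,r}}{P_{k,r}\cap \mathrm{Id}^{gr}(L)},\qquad c_n^{gr}(L)=\sum_{k=0}^{n}\binom{n}{k}c_{k,n-k}(L).$$ Then the lower graded PI-exponent of $L$ satisfies $$\underline{exp}^{gr}(L)=\liminf_{n\to\infty}\sqrt[n]{c_n^{gr}(L)}\ \ge\ 4m.$$ -/

import Mathlib

noncomputable section

/-! ### Graded polynomial identities and graded codimensions -/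

namespace GradedPI

/-- The multiset of generators (with multiplicity) occurring in a nonassociative word. -/
def leaves {α : Type*} : FreeMagma α → Multiset α
  | FreeMagma.of x => {x}
  | FreeMagma.mul u v => leaves u + leaves v

/-- The absolutely free (nonassociative, non-unital) algebra `F{X, Y}` on the even generators
`X = {x₀, x₁, …}` (`Sum.inl i` is `xᵢ`) and the odd generators `Y = {y₀, y₁, …}`
(`Sum.inr j` is `yⱼ`). -/
abbrev FreeAlg (F : Type*) [Field F] : Type _ :=
  FreeNonUnitalNonAssocAlgebra F (ℕ ⊕ ℕ)

/-- The space `P_{k,m}` of multilinear polynomials in the first `k` even generators and the first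
`m` odd generators: the span of the words in which each of these occurs exactly once and no other
generator occurs. -/
def multilinear (F : Type*) [Field F] (k m : ℕ) : Submodule F (FreeAlg F) :=
  Submodule.span F
    {f | ∃ w : FreeMagma (ℕ ⊕ ℕ),
      leaves w = (Multiset.range k).map Sum.inl + (Multiset.range m).map Sum.inr ∧
      f = MonoidAlgebra.ofMagma F (FreeMagma (ℕ ⊕ ℕ)) w}

variable {F A : Type*} [Field F] [NonUnitalNonAssocRing A] [Module F A]
  [IsScalarTower F A A] [SMulCommClass F A A]

/-- The graded identities of a (not necessarily associative) algebra `A` with homogeneous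
components `𝒜 0` (even) and `𝒜 1` (odd): the polynomials that vanish whenever the even generators
are replaced by even elements and the odd generators by odd elements. -/
def gradedIdentities (𝒜 : ZMod 2 → Submodule F A) : Submodule F (FreeAlg F) where
  carrier := {f | ∀ a b : ℕ → A, (∀ i, a i ∈ 𝒜 0) → (∀ j, b j ∈ 𝒜 1) →
    FreeNonUnitalNonAssocAlgebra.lift F (Sum.elim a b) f = 0}
  zero_mem' := fun a b _ _ => map_zero _
  add_mem' := fun {f g} hf hg a b ha hb => by
    rw [map_add, hf a b ha hb, hg a b ha hb, add_zero]
  smul_mem' := fun c f hf a b ha hb => by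
    rw [map_smul, hf a b ha hb, smul_zero]

/-- The partial graded codimension
`c_{k,m} = dim P_{k,m} / (P_{k,m} ∩ Id^gr)`. -/
def partialCodim (𝒜 : ZMod 2 → Submodule F A) (k m : ℕ) : ℕ :=
  Module.finrank F
    (multilinear F k m ⧸ (gradedIdentities 𝒜).submoduleOf (multilinear F k m))

/-- The `n`-th graded codimension. -/
def gradedCodim (𝒜 : ZMod 2 → Submodule F A) (n : ℕ) : ℕ :=
  ∑ k ∈ Finset.range (n + 1), n.choose k * partialCodim 𝒜 k (n - k)

/-- The lower graded PI-exponent: the lower limit of the `n`-th roots of the graded codimensions.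
It is a real number, so a positive lower bound for it is only possible if the sequence of roots
does not tend to infinity. -/
def lowerGradedExponent (𝒜 : ZMod 2 → Submodule F A) : ℝ :=
  Filter.liminf (fun n : ℕ => (gradedCodim 𝒜 n : ℝ) ^ (1 / (n : ℝ))) Filter.atTop

end GradedPI

/-! ### The Lie superalgebra of an associative algebra with involution -/

namespace SuperInv

/-- An `F`-linear involution of an associative `F`-algebra. -/
@[ext]
structure Involution (F R : Type*) [Field F] [Ring R] [Algebra F R] where
  /-- the underlying linear map -/
  toLin : R →ₗ[F] R
  map_mul : ∀ x y, toLin (x * y) = toLin y * toLin x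
  invol : ∀ x, toLin (toLin x) = x

section Bracket

variable {R : Type*} [Ring R]

/-- The component of `M` in `Q₀`, where `Q = M₂(R)`. -/
def evenPart (M : Matrix (Fin 2) (Fin 2) R) : Matrix (Fin 2) (Fin 2) R :=
  !![M 0 0, 0; 0, M 1 1]

/-- The component of `M` in `Q₁`, where `Q = M₂(R)`. -/
def oddPart (M : Matrix (Fin 2) (Fin 2) R) : Matrix (Fin 2) (Fin 2) R :=
  !![0, M 0 1; M 1 0, 0]

/-- The supercommutator on `Q = M₂(R)`: the biadditive extension of
`[x, y] = xy - (-1)^{|x||y|} yx` for homogeneous `x`, `y`. -/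
def superBracket (M N : Matrix (Fin 2) (Fin 2) R) : Matrix (Fin 2) (Fin 2) R :=
  (evenPart M * evenPart N - evenPart N * evenPart M)
    + (evenPart M * oddPart N - oddPart N * evenPart M)
    + (oddPart M * evenPart N - evenPart N * oddPart M)
    + (oddPart M * oddPart N + oddPart N * oddPart M)

/-- The entries of the supercommutator. -/
theorem superBracket_eq (M N : Matrix (Fin 2) (Fin 2) R) :
    superBracket M N =
      !![M 0 0 * N 0 0 - N 0 0 * M 0 0 + (M 0 1 * N 1 0 + N 0 1 * M 1 0),
          M 0 0 * N 0 1 - N 0 1 * M 1 1 + (M 0 1 * N 1 1 - N 0 0 * M 0 1);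
         M 1 1 * N 1 0 - N 1 0 * M 0 0 + (M 1 0 * N 0 0 - N 1 1 * M 1 0),
          M 1 1 * N 1 1 - N 1 1 * M 1 1 + (M 1 0 * N 0 1 + N 1 0 * M 0 1)] := by
  ext i j
  fin_cases i <;> fin_cases j <;>
    simp [superBracket, evenPart, oddPart]

end Bracket

variable {F R : Type*} [Field F] [Ring R] [Algebra F R]

/-- The subspace of `M₂(R)` of the matrices with rows `(x, y)` and `(z, -x*)`, where `y* = y` and
`z* = -z`. -/
def superSpace (σ : Involution F R) : Submodule F (Matrix (Fin 2) (Fin 2) R) where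
  carrier := {M | M 1 1 = -σ.toLin (M 0 0) ∧ σ.toLin (M 0 1) = M 0 1 ∧
    σ.toLin (M 1 0) = -M 1 0}
  zero_mem' := by simp
  add_mem' := fun {M N} hM hN => by
    obtain ⟨h1, h2, h3⟩ := hM
    obtain ⟨k1, k2, k3⟩ := hN
    refine ⟨?_, ?_, ?_⟩
    · simp only [Matrix.add_apply, map_add, h1, k1]; abel
    · simp only [Matrix.add_apply, map_add, h2, k2]
    · simp only [Matrix.add_apply, map_add, h3, k3]; abel
  smul_mem' := fun c M hM => by
    obtain ⟨h1, h2, h3⟩ := hM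
    refine ⟨?_, ?_, ?_⟩
    · simp only [Matrix.smul_apply, map_smul, h1, smul_neg]
    · simp only [Matrix.smul_apply, map_smul, h2]
    · simp only [Matrix.smul_apply, map_smul, h3, smul_neg]

/-- `superSpace σ` is closed under the supercommutator. -/
theorem superBracket_mem (σ : Involution F R) {M N : Matrix (Fin 2) (Fin 2) R}
    (hM : M ∈ superSpace σ) (hN : N ∈ superSpace σ) :
    superBracket M N ∈ superSpace σ := by
  obtain ⟨h1, h2, h3⟩ := hM
  obtain ⟨k1, k2, k3⟩ := hN
  rw [superBracket_eq]
  refine ⟨?_, ?_, ?_⟩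
  · simp only [Matrix.of_apply, Matrix.cons_val', Matrix.cons_val_zero, Matrix.cons_val_one,
      Matrix.cons_val_fin_one, map_add, map_sub, σ.map_mul, h1, h2, h3, k1, k2, k3]
    noncomm_ring
  · simp only [Matrix.of_apply, Matrix.cons_val', Matrix.cons_val_zero, Matrix.cons_val_one,
      Matrix.cons_val_fin_one, map_add, map_sub, map_neg, σ.map_mul, σ.invol, h1, h2, k1, k2]
    noncomm_ring
  · simp only [Matrix.of_apply, Matrix.cons_val', Matrix.cons_val_zero, Matrix.cons_val_one,
      Matrix.cons_val_fin_one, map_add, map_sub, map_neg, σ.map_mul, σ.invol, h1, h3, k1, k3]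
    noncomm_ring

/-- The Lie superalgebra of the associative algebra `R` with involution `σ`, with the
supercommutator as its multiplication. -/
def SuperAlg (σ : Involution F R) : Type _ := superSpace σ

namespace SuperAlg

variable {σ : Involution F R}

instance : AddCommGroup (SuperAlg σ) := inferInstanceAs (AddCommGroup (superSpace σ))

instance : Module F (SuperAlg σ) := inferInstanceAs (Module F (superSpace σ))

/-- The inclusion of the superalgebra into `M₂(R)`. -/
def toMatrix : SuperAlg σ →ₗ[F] Matrix (Fin 2) (Fin 2) R := (superSpace σ).subtype

theorem toMatrix_injective :
    Function.Injective (toMatrix : SuperAlg σ →ₗ[F] Matrix (Fin 2) (Fin 2) R) :=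
  Subtype.val_injective

instance : Mul (SuperAlg σ) :=
  ⟨fun x y => ⟨superBracket x.1 y.1, superBracket_mem σ x.2 y.2⟩⟩

theorem toMatrix_mul (x y : SuperAlg σ) :
    toMatrix (x * y) = superBracket (toMatrix x) (toMatrix y) := rfl

instance : NonUnitalNonAssocRing (SuperAlg σ) where
  left_distrib x y z := by
    apply toMatrix_injective
    simp only [toMatrix_mul, map_add, superBracket_eq]
    ext i j
    fin_cases i <;> fin_cases j <;> simp <;> noncomm_ring
  right_distrib x y z := by
    apply toMatrix_injective
    simp only [toMatrix_mul, map_add, superBracket_eq]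
    ext i j
    fin_cases i <;> fin_cases j <;> simp <;> noncomm_ring
  zero_mul x := by
    apply toMatrix_injective
    simp only [toMatrix_mul, map_zero, superBracket_eq]
    ext i j
    fin_cases i <;> fin_cases j <;> simp
  mul_zero x := by
    apply toMatrix_injective
    simp only [toMatrix_mul, map_zero, superBracket_eq]
    ext i j
    fin_cases i <;> fin_cases j <;> simp

instance : IsScalarTower F (SuperAlg σ) (SuperAlg σ) where
  smul_assoc c x y := by
    apply toMatrix_injective
    simp only [smul_eq_mul, toMatrix_mul, map_smul, superBracket_eq]
    ext i j
    fin_cases i <;> fin_cases j <;> simp [smul_add, smul_sub]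

instance : SMulCommClass F (SuperAlg σ) (SuperAlg σ) where
  smul_comm c x y := by
    apply toMatrix_injective
    simp only [smul_eq_mul, toMatrix_mul, map_smul, superBracket_eq]
    ext i j
    fin_cases i <;> fin_cases j <;> simp [smul_add, smul_sub]

end SuperAlg

/-- The `ℤ/2`-grading: the even component consists of the block diagonal matrices, the odd
component of the block antidiagonal ones. -/
def grading (σ : Involution F R) (a : ZMod 2) : Submodule F (SuperAlg σ) where
  carrier := {x | if a = 0 then
      (SuperAlg.toMatrix x 0 1 = 0 ∧ SuperAlg.toMatrix x 1 0 = 0)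
    else (SuperAlg.toMatrix x 0 0 = 0 ∧ SuperAlg.toMatrix x 1 1 = 0)}
  zero_mem' := by simp
  add_mem' := fun {x y} hx hy => by
    by_cases ha : a = 0 <;> simp_all
  smul_mem' := fun c x hx => by
    by_cases ha : a = 0 <;> simp_all

/-! ### Upper triangular matrices and their involutions -/

/-- The algebra `UT_t(F)` of upper triangular `t × t` matrices. -/
abbrev UT (F : Type*) [Field F] (t : ℕ) : Subalgebra F (Matrix (Fin t) (Fin t) F) :=
  Matrix.blockTriangularSubalgebra F F (id : Fin t → Fin t)

/-- Reflection of a matrix along the secondary diagonal: `e_{ij}` goes to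
`e_{t+1-j,t+1-i}` (indices from `1` to `t`). -/
def reflect {F : Type*} [Field F] {t : ℕ} (X : Matrix (Fin t) (Fin t) F) :
    Matrix (Fin t) (Fin t) F :=
  Matrix.of fun i j => X j.rev i.rev

theorem reflect_mul {F : Type*} [Field F] {t : ℕ} (X Y : Matrix (Fin t) (Fin t) F) :
    reflect (X * Y) = reflect Y * reflect X := by
  ext i j
  simp only [reflect, Matrix.of_apply, Matrix.mul_apply]
  rw [← Equiv.sum_comp Fin.revPerm]
  exact Finset.sum_congr rfl fun k _ => by simp [mul_comm]

theorem reflect_reflect {F : Type*} [Field F] {t : ℕ} (X : Matrix (Fin t) (Fin t) F) :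
    reflect (reflect X) = X := by
  ext i j
  simp [reflect]

theorem reflect_mem {F : Type*} [Field F] {t : ℕ} {X : Matrix (Fin t) (Fin t) F}
    (hX : X ∈ UT F t) : reflect X ∈ UT F t := by
  intro i j hij
  exact hX (Fin.rev_lt_rev.mpr hij)

/-- The orthogonal involution `∘` of `UT_t(F)`. -/
def orthogonal (F : Type*) [Field F] (t : ℕ) : Involution F (UT F t) where
  toLin :=
    { toFun := fun X => ⟨reflect X.1, reflect_mem X.2⟩
      map_add' := fun _ _ => rfl
      map_smul' := fun _ _ => rfl }
  map_mul X Y := Subtype.ext (reflect_mul X.1 Y.1)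
  invol X := Subtype.ext (reflect_reflect X.1)

/-- The matrix `D = diag(E, -E)` with `E` the identity `m × m` matrix. -/
def signMatrix (F : Type*) [Field F] (m : ℕ) : Matrix (Fin (2 * m)) (Fin (2 * m)) F :=
  Matrix.diagonal fun i => if (i : ℕ) < m then 1 else -1

theorem signMatrix_mul_self (F : Type*) [Field F] (m : ℕ) :
    signMatrix F m * signMatrix F m = 1 := by
  rw [signMatrix, Matrix.diagonal_mul_diagonal, ← Matrix.diagonal_one]
  congr 1
  ext i
  split_ifs <;> simp

theorem signMatrix_inv (F : Type*) [Field F] (m : ℕ) :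
    (signMatrix F m)⁻¹ = signMatrix F m :=
  Matrix.inv_eq_right_inv (signMatrix_mul_self F m)

theorem reflect_signMatrix (F : Type*) [Field F] (m : ℕ) :
    reflect (signMatrix F m) = -signMatrix F m := by
  ext i j
  have hi := i.isLt
  by_cases h : i = j
  · subst h
    by_cases h' : (i : ℕ) < m
    · have : ¬ (2 * m - (i + 1) < m) := by omega
      simp [reflect, signMatrix, Fin.val_rev, h', this]
    · have : 2 * m - (i + 1) < m := by omega
      simp [reflect, signMatrix, Fin.val_rev, h', this]
  · have h2 : j.rev ≠ i.rev := fun e => h (Fin.rev_injective e).symm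
    simp [reflect, signMatrix, Matrix.diagonal_apply_ne _ h, Matrix.diagonal_apply_ne _ h2]

/-- The symplectic involution `X ↦ D X∘ D⁻¹` of `UT_{2m}(F)`. -/
def symplectic (F : Type*) [Field F] (m : ℕ) : Involution F (UT F (2 * m)) where
  toLin :=
    { toFun := fun X => ⟨signMatrix F m * reflect X.1 * (signMatrix F m)⁻¹, by
        have hD : signMatrix F m ∈ UT F (2 * m) := Matrix.blockTriangular_diagonal _
        rw [signMatrix_inv]
        exact mul_mem (mul_mem hD (reflect_mem X.2)) hD⟩
      map_add' := fun X Y => Subtype.ext (by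
        change signMatrix F m * (reflect X.1 + reflect Y.1) * _ = _
        rw [mul_add, add_mul]; rfl)
      map_smul' := fun c X => Subtype.ext (by
        change signMatrix F m * (c • reflect X.1) * _ = _
        rw [mul_smul_comm, smul_mul_assoc]; rfl) }
  map_mul X Y := Subtype.ext (by
    change signMatrix F m * reflect (X.1 * Y.1) * (signMatrix F m)⁻¹ =
      (signMatrix F m * reflect Y.1 * (signMatrix F m)⁻¹) *
        (signMatrix F m * reflect X.1 * (signMatrix F m)⁻¹)
    rw [reflect_mul, signMatrix_inv]
    simp only [mul_assoc]
    rw [← mul_assoc (signMatrix F m) (signMatrix F m), signMatrix_mul_self, one_mul])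
  invol X := Subtype.ext (by
    change signMatrix F m * reflect (signMatrix F m * reflect X.1 * (signMatrix F m)⁻¹) *
      (signMatrix F m)⁻¹ = X.1
    rw [signMatrix_inv, reflect_mul, reflect_mul, reflect_reflect, reflect_signMatrix]
    simp only [neg_mul, mul_neg, neg_neg, mul_assoc]
    rw [signMatrix_mul_self, mul_one, ← mul_assoc, signMatrix_mul_self, one_mul])

end SuperInv

end

/-! For `u = e_{i,2m+1-i}` with `i ≤ m`, the involution gives `u* = u` (orthogonal) or `u* = -u`
(symplectic). Let `p` be the even element with upper left entry `u` and `q` the odd element with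
`2u` in the upper right (resp. lower left) corner. On the plane `⟨p, q⟩` four elements of `L`, two
even and two odd, built from `e_{ii}` and its image, act by left multiplication as the four `2 × 2`
matrix units; those built from another index `≤ m` annihilate the plane. Even elements lead from the
plane of `i` to that of `i - 1`. Hence there are `4m` roles, `2m` even and `2m` odd.

A left-normed word runs through all planes and uses each role `t` times. With its slot letters
replaced by these matrix units, it is nonzero exactly when each letter gets the role of its slot
(`lift_subst_word`). Renaming the slot letters thus yields `((2mt)!/t!^{2m})²` words separated by
graded substitutions, hence independent modulo the identities (`card_orbit_sq_le`). The factor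
`n.choose k` turns this into `(4mt)!/t!^{4m}` (`factorial_le_gradedCodim`), which is `(4m)^{4mt}` up
to a polynomial factor. Boundedly many filler letters reach every large `n`. -/

noncomputable section

namespace GradedPI

/-! ### Nonassociative words and their evaluation. -/

section Words

variable {α β M : Type*}

@[simp]
theorem leaves_of (x : α) : leaves (FreeMagma.of x) = {x} := rfl

@[simp]
theorem leaves_mul (u v : FreeMagma α) : leaves (u * v) = leaves u + leaves v := rfl

theorem leaves_map (f : α → β) (w : FreeMagma α) :
    leaves (FreeMagma.map f w) = (leaves w).map f := by
  induction w using FreeMagma.recOnMul with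
  | ih1 x => simp
  | ih2 u v hu hv => simp [hu, hv]

theorem lift_map [Mul M] (f : α → β) (s : β → M) (w : FreeMagma α) :
    FreeMagma.lift s (FreeMagma.map f w) = FreeMagma.lift (s ∘ f) w := by
  induction w using FreeMagma.recOnMul with
  | ih1 x => simp
  | ih2 u v hu hv => simp [hu, hv]

theorem lift_congr_of_leaves [Mul M] {s s' : α → M} {w : FreeMagma α}
    (h : ∀ x ∈ leaves w, s x = s' x) : FreeMagma.lift s w = FreeMagma.lift s' w := by
  induction w using FreeMagma.recOnMul with
  | ih1 x => simpa using h
  | ih2 u v hu hv =>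
    rw [map_mul, map_mul, hu fun x hx => h x (by simp [hx]), hv fun x hx => h x (by simp [hx])]

variable [DecidableEq α]

theorem lift_update_of_notMem [Mul M] (s : α → M) {w : FreeMagma α} {x : α}
    (h : x ∉ leaves w) (a : M) :
    FreeMagma.lift (Function.update s x a) w = FreeMagma.lift s w :=
  lift_congr_of_leaves fun y hy => Function.update_of_ne (by rintro rfl; exact h hy) _ _

theorem lift_update_add {A : Type*} [NonUnitalNonAssocRing A] (s : α → A) {w : FreeMagma α}
    {x : α} (h : (leaves w).count x = 1) (a b : A) :
    FreeMagma.lift (Function.update s x (a + b)) w =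
      FreeMagma.lift (Function.update s x a) w + FreeMagma.lift (Function.update s x b) w := by
  induction w using FreeMagma.recOnMul with
  | ih1 y =>
    obtain rfl : x = y := by
      by_contra hxy
      simp [hxy] at h
    simp
  | ih2 u v hu hv =>
    rw [leaves_mul, Multiset.count_add] at h
    have key : (leaves u).count x = 1 ∧ (leaves v).count x = 0 ∨
        (leaves u).count x = 0 ∧ (leaves v).count x = 1 := by omega
    obtain ⟨h1, h0⟩ | ⟨h0, h1⟩ := key
    · simp only [map_mul, hu h1, lift_update_of_notMem s (Multiset.count_eq_zero.mp h0), add_mul]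
    · simp only [map_mul, hv h1, lift_update_of_notMem s (Multiset.count_eq_zero.mp h0), mul_add]

theorem lift_update_smul {F A : Type*} [Field F] [NonUnitalNonAssocRing A] [Module F A]
    [IsScalarTower F A A] [SMulCommClass F A A] (s : α → A) {w : FreeMagma α}
    {x : α} (h : (leaves w).count x = 1) (c : F) (a : A) :
    FreeMagma.lift (Function.update s x (c • a)) w =
      c • FreeMagma.lift (Function.update s x a) w := by
  induction w using FreeMagma.recOnMul with
  | ih1 y =>
    obtain rfl : x = y := by
      by_contra hxy
      simp [hxy] at h
    simp
  | ih2 u v hu hv =>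
    rw [leaves_mul, Multiset.count_add] at h
    have key : (leaves u).count x = 1 ∧ (leaves v).count x = 0 ∨
        (leaves u).count x = 0 ∧ (leaves v).count x = 1 := by omega
    obtain ⟨h1, h0⟩ | ⟨h0, h1⟩ := key
    · simp only [map_mul, hu h1, lift_update_of_notMem s (Multiset.count_eq_zero.mp h0),
        smul_mul_assoc]
    · simp only [map_mul, hv h1, lift_update_of_notMem s (Multiset.count_eq_zero.mp h0),
        mul_smul_comm]

end Words

/-! ### Multilinear evaluation and bounds for the codimensions. -/

variable {F A : Type*} [Field F] [NonUnitalNonAssocRing A] [Module F A]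
  [IsScalarTower F A A] [SMulCommClass F A A]

theorem lift_ofMagma (s : ℕ ⊕ ℕ → A) (w : FreeMagma (ℕ ⊕ ℕ)) :
    FreeNonUnitalNonAssocAlgebra.lift F s (MonoidAlgebra.ofMagma F _ w) = FreeMagma.lift s w := by
  induction w using FreeMagma.recOnMul with
  | ih1 x => exact FreeNonUnitalNonAssocAlgebra.lift_of_apply F s x
  | ih2 u v hu hv => rw [map_mul, map_mul, map_mul, hu, hv]

/-- The inclusion of the first `k` even and the first `r` odd generators. -/
def genEmb (k r : ℕ) : Fin k ⊕ Fin r ↪ ℕ ⊕ ℕ :=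
  Function.Embedding.sumMap Fin.valEmbedding Fin.valEmbedding

theorem map_genEmb_univ (k r : ℕ) :
    (Finset.univ : Finset (Fin k ⊕ Fin r)).val.map (genEmb k r) =
      (Multiset.range k).map Sum.inl + (Multiset.range r).map Sum.inr := by
  have h : ∀ n : ℕ, (Finset.univ : Finset (Fin n)).val.map Fin.val = Multiset.range n := by
    intro n
    have := Fin.map_valEmbedding_univ (n := n)
    have h2 := congrArg Finset.val this
    simp only [Finset.map_val] at h2
    rw [show Multiset.range n = (Finset.range n).val from rfl, ← Nat.Iio_eq_range, ← h2]
    rfl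
  rw [← h k, ← h r]
  simp only [Multiset.map_map]
  have : (Finset.univ : Finset (Fin k ⊕ Fin r)).val =
      (Finset.univ : Finset (Fin k)).val.map Sum.inl
        + (Finset.univ : Finset (Fin r)).val.map Sum.inr := rfl
  rw [this, Multiset.map_add, Multiset.map_map, Multiset.map_map]
  rfl

theorem extend_update_of_injective {α β γ : Type*} [DecidableEq α] [DecidableEq β] {f : α → β}
    (hf : Function.Injective f) (t : α → γ) (g : β → γ) (v : α) (x : γ) :
    Function.extend f (Function.update t v x) g =
      Function.update (Function.extend f t g) (f v) x := by
  funext y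
  by_cases hy : ∃ a, f a = y
  · obtain ⟨a, rfl⟩ := hy
    rw [hf.extend_apply]
    by_cases hav : a = v
    · subst hav; simp
    · rw [Function.update_of_ne hav, Function.update_of_ne (hf.ne hav), hf.extend_apply]
  · rw [Function.extend_apply' _ _ _ hy, Function.update_of_ne (by rintro rfl; exact hy ⟨v, rfl⟩),
      Function.extend_apply' _ _ _ hy]

/-- The evaluation of a multilinear polynomial, as a multilinear map. -/
def evalMultilinear (k r : ℕ) (f : multilinear F k r) :
    MultilinearMap F (fun _ : Fin k ⊕ Fin r => A) A where
  toFun t := FreeNonUnitalNonAssocAlgebra.lift F (Function.extend (genEmb k r) t 0) f.1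
  map_update_add' {inst} t v x y := by
    have hs : ∀ x, Function.extend (genEmb k r) (Function.update t v x) 0 =
        Function.update (Function.extend (genEmb k r) t (0 : ℕ ⊕ ℕ → A)) (genEmb k r v) x :=
      fun x => by
        exact extend_update_of_injective (genEmb k r).injective _ _ _ _
    rw [hs, hs, hs]
    obtain ⟨f, hf⟩ := f
    simp only
    induction hf using Submodule.span_induction with
    | mem f hf =>
      obtain ⟨w, hw, rfl⟩ := hf
      simp only [lift_ofMagma]
      refine lift_update_add _ ?_ x y
      rw [hw, ← map_genEmb_univ, Multiset.count_map_eq_count' _ _ (genEmb k r).injective]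
      exact Multiset.count_univ v
    | zero => simp
    | add f g _ _ hf hg => rw [map_add, hf, hg, map_add, map_add]; abel
    | smul c f _ hf => rw [map_smul, hf, map_smul, map_smul, smul_add]
  map_update_smul' {inst} t v c x := by
    have hs : ∀ x, Function.extend (genEmb k r) (Function.update t v x) 0 =
        Function.update (Function.extend (genEmb k r) t (0 : ℕ ⊕ ℕ → A)) (genEmb k r v) x :=
      fun x => by
        exact extend_update_of_injective (genEmb k r).injective _ _ _ _
    rw [hs, hs]
    obtain ⟨f, hf⟩ := f
    simp only
    induction hf using Submodule.span_induction with
    | mem f hf =>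
      obtain ⟨w, hw, rfl⟩ := hf
      simp only [lift_ofMagma]
      refine lift_update_smul _ ?_ c x
      rw [hw, ← map_genEmb_univ, Multiset.count_map_eq_count' _ _ (genEmb k r).injective]
      exact Multiset.count_univ v
    | zero => simp
    | add f g _ _ hf hg => rw [map_add, hf, hg, map_add, smul_add]
    | smul d f _ hf => rw [map_smul, hf, map_smul, smul_comm]

theorem lift_eq_evalMultilinear (k r : ℕ) (f : multilinear F k r) (s : ℕ ⊕ ℕ → A) :
    FreeNonUnitalNonAssocAlgebra.lift F s f.1 = evalMultilinear k r f (s ∘ genEmb k r) := by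
  change _ = FreeNonUnitalNonAssocAlgebra.lift F
    (Function.extend (genEmb k r) (s ∘ genEmb k r) 0) f.1
  obtain ⟨f, hf⟩ := f
  simp only
  induction hf using Submodule.span_induction with
  | mem f hf =>
    obtain ⟨w, hw, rfl⟩ := hf
    rw [lift_ofMagma, lift_ofMagma]
    refine lift_congr_of_leaves fun x hx => ?_
    rw [hw, ← map_genEmb_univ, Multiset.mem_map] at hx
    obtain ⟨v, -, rfl⟩ := hx
    rw [(genEmb k r).injective.extend_apply, Function.comp_apply]
  | zero => simp
  | add f g _ _ hf hg => rw [map_add, hf, hg, map_add]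
  | smul d f _ hf => rw [map_smul, hf, map_smul]

/-- The values of a multilinear polynomial on the tuples of members of a given family. -/
def evalOn (k r : ℕ) {ι : Type*} (b : ι → A) :
    multilinear F k r →ₗ[F] (Fin k ⊕ Fin r → ι) → A where
  toFun f v := evalMultilinear k r f (b ∘ v)
  map_add' f g := by ext v; exact map_add (FreeNonUnitalNonAssocAlgebra.lift F _) f.1 g.1
  map_smul' c f := by ext v; exact map_smul (FreeNonUnitalNonAssocAlgebra.lift F _) c f.1

/-- A multilinear map that vanishes on tuples of basis vectors is zero, so such a polynomial
vanishes under all substitutions, graded or not. -/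
theorem ker_evalOn_le (𝒜 : ZMod 2 → Submodule F A) (k r : ℕ) {ι : Type*}
    (b : Module.Basis ι F A) :
    LinearMap.ker (evalOn k r b) ≤ (gradedIdentities 𝒜).submoduleOf (multilinear F k r) := by
  intro f hf
  have h0 : evalMultilinear (A := A) k r f = 0 :=
    Module.Basis.ext_multilinear (fun _ => b) fun v => congrFun (LinearMap.mem_ker.mp hf) v
  intro s t _ _
  change FreeNonUnitalNonAssocAlgebra.lift F _ f.1 = 0
  rw [lift_eq_evalMultilinear, h0]
  rfl

variable [Module.Finite F A]

/-- Since `finrank` is `0` in infinite dimension, independent families bound the codimension from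
below only once this is known. -/
instance finite_quotient (𝒜 : ZMod 2 → Submodule F A) (k r : ℕ) :
    Module.Finite F
      (multilinear F k r ⧸ (gradedIdentities 𝒜).submoduleOf (multilinear F k r)) := by
  let b := Module.finBasis F A
  have : Module.Finite F (multilinear F k r ⧸ LinearMap.ker (evalOn k r b)) :=
    Module.Finite.equiv (evalOn k r b).quotKerEquivRange.symm
  exact Module.Finite.of_surjective (Submodule.factor (ker_evalOn_le 𝒜 k r b))
    (Submodule.factor_surjective _)

theorem partialCodim_le (𝒜 : ZMod 2 → Submodule F A) (k r : ℕ) :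
    partialCodim 𝒜 k r ≤ Module.finrank F A ^ (k + r) * Module.finrank F A := by
  let b := Module.finBasis F A
  have : Module.Finite F (multilinear F k r ⧸ LinearMap.ker (evalOn k r b)) :=
    Module.Finite.equiv (evalOn k r b).quotKerEquivRange.symm
  calc partialCodim 𝒜 k r
      ≤ Module.finrank F (multilinear F k r ⧸ LinearMap.ker (evalOn k r b)) :=
        LinearMap.finrank_le_finrank_of_surjective
          (Submodule.factor_surjective (ker_evalOn_le 𝒜 k r b))
    _ = Module.finrank F (LinearMap.range (evalOn k r b)) :=
        (evalOn k r b).quotKerEquivRange.finrank_eq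
    _ ≤ Module.finrank F ((Fin k ⊕ Fin r → Fin (Module.finrank F A)) → A) :=
        Submodule.finrank_le _
    _ = _ := by
        rw [Module.finrank_pi_fintype]
        simp

/-- Exponential growth keeps the roots bounded, which the real-valued `liminf` needs. -/
theorem gradedCodim_le (𝒜 : ZMod 2 → Submodule F A) (n : ℕ) :
    gradedCodim 𝒜 n ≤ 2 ^ n * Module.finrank F A ^ (n + 1) := by
  rw [← Nat.sum_range_choose, Finset.sum_mul]
  refine Finset.sum_le_sum fun k hk => Nat.mul_le_mul_left _ ?_
  refine (partialCodim_le 𝒜 k (n - k)).trans_eq ?_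
  rw [Nat.add_sub_cancel' (by simpa [Nat.lt_succ_iff] using hk), pow_succ]

/-- Words that are separated by graded substitutions are linearly independent modulo the graded
identities. -/
theorem card_le_partialCodim (𝒜 : ZMod 2 → Submodule F A) {V W I : Type*} [Fintype V] [Fintype W]
    [Fintype I] (w : I → FreeMagma (V ⊕ W)) (hw : ∀ i, leaves (w i) = Finset.univ.val)
    (s : I → V ⊕ W → A) (hs₀ : ∀ i v, s i (Sum.inl v) ∈ 𝒜 0) (hs₁ : ∀ i v, s i (Sum.inr v) ∈ 𝒜 1)
    (h : ∀ i j, FreeMagma.lift (s j) (w i) = 0 ↔ i ≠ j) :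
    Fintype.card I ≤ partialCodim 𝒜 (Fintype.card V) (Fintype.card W) := by
  classical
  set k := Fintype.card V
  set r := Fintype.card W
  let e : V ⊕ W ≃ Fin k ⊕ Fin r := (Fintype.equivFin V).sumCongr (Fintype.equivFin W)
  let word : I → FreeMagma (ℕ ⊕ ℕ) := fun i => FreeMagma.map (genEmb k r ∘ e) (w i)
  have hword : ∀ i, MonoidAlgebra.ofMagma F _ (word i) ∈ multilinear F k r := by
    refine fun i => Submodule.subset_span ⟨word i, ?_, rfl⟩
    rw [leaves_map, hw, ← Multiset.map_map, ← map_genEmb_univ]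
    congr 1
    exact congrArg Finset.val (Finset.map_univ_equiv e)
  let vec : I → multilinear F k r := fun i => ⟨_, hword i⟩
  -- The unused generators go to `0`, which is homogeneous of either degree, so the substitution
  -- stays graded.
  let sub : I → ℕ ⊕ ℕ → A := fun j => Function.extend (genEmb k r) (s j ∘ e.symm) 0
  have hval : ∀ i j, FreeNonUnitalNonAssocAlgebra.lift F (sub j) (vec i).1 =
      FreeMagma.lift (s j) (w i) := by
    intro i j
    rw [lift_ofMagma, lift_map]
    congr 2
    funext x
    simp [sub, (genEmb k r).injective.extend_apply]
  have hsub : ∀ (j : I) (f : FreeAlg F), f ∈ gradedIdentities 𝒜 →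
      FreeNonUnitalNonAssocAlgebra.lift F (sub j) f = 0 := by
    intro j f hf
    have := hf (sub j ∘ Sum.inl) (sub j ∘ Sum.inr) ?_ ?_
    · rwa [Sum.elim_comp_inl_inr] at this
    · intro i
      by_cases hi : i < k
      · have : (Sum.inl i : ℕ ⊕ ℕ) = genEmb k r (Sum.inl ⟨i, hi⟩) := rfl
        simp only [Function.comp_apply, sub]
        rw [this, (genEmb k r).injective.extend_apply]
        exact hs₀ j _
      · simp only [Function.comp_apply, sub]
        rw [Function.extend_apply' _ _ _ (by
          rintro ⟨x | x, hx⟩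
          · exact hi (Sum.inl.inj hx ▸ x.2)
          · exact absurd hx (by simp [genEmb]))]
        exact zero_mem _
    · intro i
      by_cases hi : i < r
      · have : (Sum.inr i : ℕ ⊕ ℕ) = genEmb k r (Sum.inr ⟨i, hi⟩) := rfl
        simp only [Function.comp_apply, sub]
        rw [this, (genEmb k r).injective.extend_apply]
        exact hs₁ j _
      · simp only [Function.comp_apply, sub]
        rw [Function.extend_apply' _ _ _ (by
          rintro ⟨x | x, hx⟩
          · exact absurd hx (by simp [genEmb])
          · exact hi (Sum.inr.inj hx ▸ x.2))]
        exact zero_mem _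
  refine LinearIndependent.fintype_card_le_finrank (R := F)
    (b := fun i => Submodule.Quotient.mk (vec i)) ?_
  rw [Fintype.linearIndependent_iff]
  intro g hg j
  have hmem : ∑ i, g i • vec i ∈ (gradedIdentities 𝒜).submoduleOf (multilinear F k r) := by
    rw [← Submodule.Quotient.mk_eq_zero, ← hg, ← Submodule.mkQ_apply, map_sum]
    rfl
  -- The `j`-th substitution kills every term of the relation except the `j`-th.
  have h2 := hsub j _ hmem
  rw [Submodule.coe_subtype, Submodule.coe_sum, map_sum,
    Finset.sum_eq_single j] at h2
  · rw [Submodule.coe_smul, map_smul, hval] at h2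
    exact (smul_eq_zero.mp h2).resolve_right fun h' => (h j j).mp h' rfl
  · intro i _ hij
    rw [Submodule.coe_smul, map_smul, hval, (h i j).mpr hij, smul_zero]
  · simp

end GradedPI

/-! ### Growth of roots and of multinomial coefficients. -/

open Filter Topology in
-- The polynomial factor has `n`-th root tending to `1`; `hupper` only excludes an unbounded
-- sequence of roots.
theorem le_liminf_root_of_pow_le (u : ℕ → ℕ) (N K a d n₀ : ℕ)
    (hupper : ∀ n, u n ≤ 2 ^ n * d ^ (n + 1))
    (hlower : ∀ n, n₀ ≤ n → N ^ n ≤ K * n ^ a * u n) :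
    (N : ℝ) ≤ liminf (fun n : ℕ => (u n : ℝ) ^ (1 / (n : ℝ))) atTop := by
  have hub : ∀ᶠ n : ℕ in atTop, (u n : ℝ) ^ (1 / (n : ℝ)) ≤ 2 * (d : ℝ) ^ 2 := by
    filter_upwards [eventually_ge_atTop 1] with n hn
    have hn0 : n ≠ 0 := by omega
    have h1 : (u n : ℝ) ≤ (2 * (d : ℝ) ^ 2) ^ n := by
      have h2 : u n ≤ (2 * d ^ 2) ^ n := by
        refine (hupper n).trans ?_
        rw [mul_pow, ← pow_mul]
        refine Nat.mul_le_mul_left _ ?_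
        rcases Nat.eq_zero_or_pos d with rfl | hd
        · simp
        · exact Nat.pow_le_pow_right hd (by omega)
      exact_mod_cast h2
    calc (u n : ℝ) ^ (1 / (n : ℝ)) ≤ ((2 * (d : ℝ) ^ 2) ^ n) ^ (1 / (n : ℝ)) :=
          Real.rpow_le_rpow (Nat.cast_nonneg _) h1 (by positivity)
      _ = 2 * (d : ℝ) ^ 2 := by
          rw [one_div, Real.pow_rpow_inv_natCast (by positivity) hn0]
  rcases Nat.eq_zero_or_pos N with rfl | hN
  · refine le_liminf_of_le (IsBoundedUnder.isCoboundedUnder_ge ⟨_, hub⟩) ?_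
    filter_upwards with n
    simp only [Nat.cast_zero]
    positivity
  have hK : 0 < K := by
    have := hlower (max n₀ 1) (le_max_left _ _)
    rcases Nat.eq_zero_or_pos K with rfl | h
    · have : 0 < N ^ max n₀ 1 := Nat.pow_pos hN
      simp_all
    · exact h
  have hK' : (0 : ℝ) < K := by exact_mod_cast hK
  set c : ℕ → ℝ := fun n => (K : ℝ) ^ (1 / (n : ℝ)) * (n : ℝ) ^ ((a : ℝ) / n) with hc
  have hc1 : Tendsto c atTop (𝓝 1) := by
    have h1 : Tendsto (fun n : ℕ => (K : ℝ) ^ (1 / (n : ℝ))) atTop (𝓝 1) := by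
      have := (Real.continuousAt_const_rpow hK'.ne' (b := 0)).tendsto.comp
        (tendsto_one_div_atTop_nhds_zero_nat (𝕜 := ℝ))
      simpa [Function.comp_def] using this
    have h2 : Tendsto (fun n : ℕ => (n : ℝ) ^ ((a : ℝ) / n)) atTop (𝓝 1) := by
      have := (tendsto_rpow_div_mul_add a 1 0 (by norm_num)).comp
        (tendsto_natCast_atTop_atTop (R := ℝ))
      simpa [Function.comp_def] using this
    simpa [hc] using h1.mul h2
  have hlim : Tendsto (fun n => (N : ℝ) / c n) atTop (𝓝 N) := by
    simpa [Pi.div_def] using (tendsto_const_nhds (x := (N : ℝ))).div hc1 one_ne_zero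
  rw [← hlim.liminf_eq]
  refine liminf_le_liminf ?_ hlim.isBoundedUnder_ge
    (IsBoundedUnder.isCoboundedUnder_ge ⟨_, hub⟩)
  filter_upwards [eventually_ge_atTop n₀, eventually_ge_atTop 1] with n hn hn1
  have hn0 : n ≠ 0 := by omega
  have hnpos : (0 : ℝ) < n := by exact_mod_cast hn1
  have hcpos : 0 < c n := by simp only [hc]; positivity
  rw [div_le_iff₀ hcpos]
  have h1 : ((N : ℝ)) ^ n ≤ (K : ℝ) * (n : ℝ) ^ a * u n := by exact_mod_cast hlower n hn
  have h2 := Real.rpow_le_rpow (by positivity) h1 (show 0 ≤ 1 / (n : ℝ) by positivity)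
  rw [one_div, Real.pow_rpow_inv_natCast (by positivity) hn0, ← one_div,
    Real.mul_rpow (by positivity) (by positivity), Real.mul_rpow (by positivity) (by positivity),
    ← Real.rpow_natCast, ← Real.rpow_mul hnpos.le, mul_one_div] at h2
  simp only [hc]
  linarith

/-- In passing from `t` to `t + 1` the left side gains `(N(t+1))^N`, the new polynomial factor,
while the old one is absorbed by `(Nt)! (Nt+1)^N ≤ (Nt+N)!`. -/
theorem pow_mul_factorial_pow_le (N : ℕ) {t : ℕ} (ht : 1 ≤ t) :
    N ^ (N * t) * t.factorial ^ N ≤ (N * t).factorial * (N * t) ^ N := by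
  induction t, ht using Nat.le_induction with
  | base =>
    simpa using Nat.le_mul_of_pos_left (N ^ N) N.factorial_pos
  | succ t ht ih =>
    calc N ^ (N * (t + 1)) * (t + 1).factorial ^ N
        = (N ^ (N * t) * t.factorial ^ N) * (N * (t + 1)) ^ N := by
          rw [Nat.factorial_succ, mul_pow, mul_pow, mul_add N t 1, pow_add, mul_one]; ring
      _ ≤ ((N * t).factorial * (N * t) ^ N) * (N * (t + 1)) ^ N := Nat.mul_le_mul_right _ ih
      _ ≤ (N * t + N).factorial * (N * (t + 1)) ^ N := by
          refine Nat.mul_le_mul_right _ (le_trans ?_ Nat.factorial_mul_pow_le_factorial)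
          exact Nat.mul_le_mul_left _ (Nat.pow_le_pow_left (Nat.le_succ _) _)
      _ = _ := by rw [mul_add, mul_one]

/-- Orbit-stabilizer: the stabilizer of `Prod.fst` is the product of the symmetric groups of its
fibres, each of size `t`. -/
theorem card_orbit_fst_mul (ι : Type*) [Fintype ι] (t : ℕ) :
    Nat.card (MulAction.orbit (Equiv.Perm (ι × Fin t))ᵈᵐᵃ (Prod.fst : ι × Fin t → ι)) *
      t.factorial ^ Fintype.card ι = (Fintype.card ι * t).factorial := by
  classical
  have hstab : Nat.card (MulAction.stabilizer (Equiv.Perm (ι × Fin t))ᵈᵐᵃ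
      (Prod.fst : ι × Fin t → ι)) = t.factorial ^ Fintype.card ι := by
    have h1 : Nat.card (MulAction.stabilizer (Equiv.Perm (ι × Fin t))ᵈᵐᵃ
        (Prod.fst : ι × Fin t → ι)) =
        Nat.card {g : Equiv.Perm (ι × Fin t) // (Prod.fst : ι × Fin t → ι) ∘ g = Prod.fst} :=
      Nat.card_congr (Equiv.subtypeEquiv DomMulAct.mk.symm fun _ => DomMulAct.mem_stabilizer_iff)
    rw [h1, Nat.card_eq_fintype_card, DomMulAct.stabilizer_card]
    have h2 : ∀ i : ι, Fintype.card {a : ι × Fin t // a.1 = i} = t := by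
      intro i
      rw [Fintype.card_congr (β := Fin t)
        { toFun := fun a => a.1.2
          invFun := fun j => ⟨(i, j), rfl⟩
          left_inv := by rintro ⟨⟨a, b⟩, rfl⟩; rfl
          right_inv := fun _ => rfl }, Fintype.card_fin]
    simp [h2]
  let := Fintype.ofEquiv (Equiv.Perm (ι × Fin t)) DomMulAct.mk
  let := Fintype.ofFinite
    (MulAction.stabilizer (Equiv.Perm (ι × Fin t))ᵈᵐᵃ (Prod.fst : ι × Fin t → ι))
  let := Fintype.ofFinite
    (MulAction.orbit (Equiv.Perm (ι × Fin t))ᵈᵐᵃ (Prod.fst : ι × Fin t → ι))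
  have := MulAction.card_orbit_mul_card_stabilizer_eq_card_group
    (Equiv.Perm (ι × Fin t))ᵈᵐᵃ (Prod.fst : ι × Fin t → ι)
  simp only [← Nat.card_eq_fintype_card] at this
  rw [hstab, Nat.card_congr DomMulAct.mk.symm, Nat.card_perm] at this
  simpa using this

namespace GradedPI

/-! ### Left-normed words and their action. -/

section LeftNormed

variable {α β M : Type*}

/-- The word `vₙ(⋯(v₂(v₁u)))` for a list `v₁, …, vₙ`. -/
def leftAct (u : FreeMagma α) (L : List α) : FreeMagma α :=
  L.foldl (fun w v => FreeMagma.of v * w) u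

theorem leaves_leftAct (u : FreeMagma α) (L : List α) :
    leaves (leftAct u L) = leaves u + (L : Multiset α) := by
  induction L generalizing u with
  | nil => simp [leftAct]
  | cons v L ih =>
    have := ih (FreeMagma.of v * u)
    simp only [leftAct, List.foldl_cons] at this ⊢
    rw [this, leaves_mul, leaves_of, ← Multiset.cons_coe, ← Multiset.singleton_add]
    abel

theorem lift_leftAct [Mul M] (s : α → M) (u : FreeMagma α) (L : List α) :
    FreeMagma.lift s (leftAct u L) = L.foldl (fun a v => s v * a) (FreeMagma.lift s u) := by
  induction L generalizing u with
  | nil => rfl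
  | cons v L ih =>
    have := ih (FreeMagma.of v * u)
    simp only [leftAct, List.foldl_cons, map_mul, FreeMagma.lift_of] at this ⊢
    exact this

variable [NonUnitalNonAssocRing M]

/-- Acting with the list `L` under the substitution `s` sends `x` to `y` if all letters of `L`
satisfy `ok`, and to `0` otherwise. -/
def Transfers (s : α → M) (ok : α → Prop) (L : List α) (x y : M) : Prop :=
  L.foldl (fun a v => s v * a) x = open Classical in if ∀ v ∈ L, ok v then y else 0

variable {s : α → M} {ok : α → Prop}

theorem foldl_mul_zero (s : α → M) (L : List α) : L.foldl (fun a v => s v * a) 0 = 0 := by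
  induction L with
  | nil => rfl
  | cons v L ih => rw [List.foldl_cons, mul_zero, ih]

theorem Transfers.nil (x : M) : Transfers s ok [] x x := by simp [Transfers]

/-- Once a bad letter has produced `0`, later letters cannot undo it. -/
theorem Transfers.append {L L' : List α} {x y z : M} (h : Transfers s ok L x y)
    (h' : Transfers s ok L' y z) : Transfers s ok (L ++ L') x z := by
  classical
  unfold Transfers at *
  rw [List.foldl_append, h]
  simp only [List.mem_append, or_imp, forall_and]
  by_cases h1 : ∀ v ∈ L, ok v
  · rw [if_pos h1, h']
    exact if_congr (and_iff_right h1).symm rfl rfl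
  · rw [if_neg h1, foldl_mul_zero, if_neg fun h2 => h1 h2.1]

theorem Transfers.cons {v : α} {L : List α} {x y z : M} (hok : ok v → s v * x = y)
    (hbad : ¬ ok v → s v * x = 0) (h : Transfers s ok L y z) : Transfers s ok (v :: L) x z := by
  refine Transfers.append (L := [v]) (y := y) ?_ h
  by_cases hv : ok v
  · simp [Transfers, hv, hok hv]
  · simp [Transfers, hv, hbad hv]

theorem Transfers.flatMap_const {J : List β} {f : β → List α} {x : M}
    (h : ∀ j ∈ J, Transfers s ok (f j) x x) : Transfers s ok (J.flatMap f) x x := by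
  induction J with
  | nil => exact Transfers.nil x
  | cons j J ih =>
    rw [List.flatMap_cons]
    exact (h j (by simp)).append (ih fun j hj => h j (by simp [hj]))

theorem Transfers.flatMap_finRange {m : ℕ} {f : Fin m → List α} (p : ℕ → M)
    (h : ∀ l : Fin m, Transfers s ok (f l) (p l) (p (l + 1))) :
    Transfers s ok ((List.finRange m).flatMap f) (p 0) (p m) := by
  induction m with
  | zero => exact Transfers.nil _
  | succ m ih =>
    rw [List.finRange_succ_last, List.flatMap_append, List.flatMap_map]
    refine (ih fun l => h l.castSucc).append ?_
    simpa using h (Fin.last m)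

end LeftNormed

/-! ### Chains of modules and the lower bound they give. -/

variable {F A : Type*} [Field F] [NonUnitalNonAssocRing A] [Module F A]

/-- A chain of `m` two-dimensional modules `⟨p l, q l⟩`: on the `l`-th one the elements
`ev (l, ·)` act as the two diagonal matrix units, the elements `od (l, ·)` as the two
off-diagonal ones, and all other `ev` and `od` act as zero; `conn (l, true) * (conn (l, false) * ·)`
leads from `p l` to `p (l + 1)`. -/
structure ModuleChain (𝒜 : ZMod 2 → Submodule F A) (m : ℕ) where
  /-- the even basis vectors -/
  p : ℕ → A
  /-- the odd basis vectors -/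
  q : Fin m → A
  /-- the diagonal matrix units -/
  ev : Fin m × Bool → A
  /-- the off-diagonal matrix units -/
  od : Fin m × Bool → A
  /-- the connecting elements -/
  conn : Fin m × Bool → A
  p_mem : p 0 ∈ 𝒜 0
  ev_mem : ∀ i, ev i ∈ 𝒜 0
  od_mem : ∀ i, od i ∈ 𝒜 1
  conn_mem : ∀ i, conn i ∈ 𝒜 0
  ev_mul_p : ∀ i (l : Fin m), ev i * p l = if i = (l, false) then p l else 0
  ev_mul_q : ∀ i (l : Fin m), ev i * q l = if i = (l, true) then q l else 0
  od_mul_p : ∀ i (l : Fin m), od i * p l = if i = (l, false) then q l else 0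
  od_mul_q : ∀ i (l : Fin m), od i * q l = if i = (l, true) then p l else 0
  conn_mul : ∀ l : Fin m, conn (l, true) * (conn (l, false) * p l) = p (l + 1)
  p_ne_zero : p m ≠ 0

namespace ModuleChain

variable {𝒜 : ZMod 2 → Submodule F A} {m : ℕ} (e t : ℕ)

/-- The letters that stand at `t` places in each of the `2m` roles. -/
abbrev Slot (m t : ℕ) : Type := (Fin m × Bool) × Fin t

/-- The letters: the initial one, `e` letters to fill up, the connecting ones, and even and odd
letters for the slots. -/
abbrev Letter (m e t : ℕ) : Type :=
  (Option (Fin e ⊕ Fin m × Bool) ⊕ Slot m t) ⊕ Slot m t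

/-- The block of letters that acts on the `l`-th module. -/
def block (m e t : ℕ) (l : Fin m) : List (Letter m e t) :=
  ((List.finRange t).flatMap fun j =>
    [.inl (.inr ((l, false), j)), .inr ((l, false), j),
      .inl (.inr ((l, true), j)), .inr ((l, true), j)]) ++
    [.inl (.inl (some (.inr (l, false)))), .inl (.inl (some (.inr (l, true))))]

/-- The letters of the word that passes through all modules of the chain, apart from the initial
one. -/
def route (m e t : ℕ) : List (Letter m e t) :=
  (List.finRange e).map (fun i => .inl (.inl (some (.inl i)))) ++
    (List.finRange m).flatMap (block m e t)

/-- The word that passes through all modules of the chain. -/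
def word (m e t : ℕ) : FreeMagma (Letter m e t) :=
  leftAct (FreeMagma.of (.inl (.inl none))) (route m e t)

theorem mem_route (v : Letter m e t) : v ∈ Sum.inl (Sum.inl none) :: route m e t := by
  rcases v with ((_ | (i | ⟨l, b⟩)) | ⟨⟨l, b⟩, j⟩) | ⟨⟨l, b⟩, j⟩
  · simp
  · simp [route]
  all_goals cases b <;> simp [route, block]

/-- Every letter occurs, and the length equals the number of letters, so none is repeated. -/
theorem leaves_word : leaves (word m e t) = Finset.univ.val := by
  symm
  have : leaves (word m e t) =
      ((Sum.inl (Sum.inl none) :: route m e t : List (Letter m e t)) : Multiset _) := by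
    rw [word, leaves_leftAct, leaves_of, ← Multiset.cons_coe, Multiset.singleton_add]
  rw [this]
  refine Multiset.eq_of_le_of_card_le ?_ ?_
  · rw [Multiset.le_iff_subset Finset.univ.nodup]
    exact fun v _ => mem_route e t v
  · rw [Finset.card_val, Finset.card_univ, Multiset.coe_card]
    simp [route, block, List.length_flatMap]
    ring_nf
    omega

/-- The substitution that sends the slot letters to the matrix units chosen by `g` and `h`. -/
def subst (c : ModuleChain 𝒜 m) (hm : 0 < m) (g h : Slot m t → Fin m × Bool) : Letter m e t → A
  | .inl (.inl none) => c.p 0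
  | .inl (.inl (some (.inl _))) => c.ev (⟨0, hm⟩, false)
  | .inl (.inl (some (.inr i))) => c.conn i
  | .inl (.inr x) => c.ev (g x)
  | .inr x => c.od (h x)

/-- Only one matrix unit of the right parity preserves the path at each slot, so the path from `p 0`
to `p m` survives exactly for the intended roles. -/
theorem lift_subst_word (c : ModuleChain 𝒜 m) (hm : 0 < m) (g h : Slot m t → Fin m × Bool) :
    FreeMagma.lift (c.subst e t hm g h) (word m e t) = 0 ↔
      ¬ (g = Prod.fst ∧ h = Prod.fst) := by
  classical
  let ok : Letter m e t → Prop
    | .inl (.inl _) => True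
    | .inl (.inr x) => g x = x.1
    | .inr x => h x = x.1
  have hblock : ∀ l, Transfers (c.subst e t hm g h) ok (block m e t l) (c.p l) (c.p (l + 1)) := by
    intro l
    refine Transfers.append (y := c.p l) (Transfers.flatMap_const fun j _ => ?_) ?_
    -- Four consecutive slots form the loop `p → p → q → q → p`, using each matrix unit once.
    · refine .cons (y := c.p l) ?_ ?_ (.cons (y := c.q l) ?_ ?_ (.cons (y := c.q l) ?_ ?_
        (.cons (y := c.p l) ?_ ?_ (.nil _))))
      · intro hv; simp only [ok] at hv; simp [subst, c.ev_mul_p, hv]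
      · intro hv; simp only [ok] at hv; simp [subst, c.ev_mul_p, hv]
      · intro hv; simp only [ok] at hv; simp [subst, c.od_mul_p, hv]
      · intro hv; simp only [ok] at hv; simp [subst, c.od_mul_p, hv]
      · intro hv; simp only [ok] at hv; simp [subst, c.ev_mul_q, hv]
      · intro hv; simp only [ok] at hv; simp [subst, c.ev_mul_q, hv]
      · intro hv; simp only [ok] at hv; simp [subst, c.od_mul_q, hv]
      · intro hv; simp only [ok] at hv; simp [subst, c.od_mul_q, hv]
    · simp [Transfers, subst, ok, c.conn_mul]
  have hroute : Transfers (c.subst e t hm g h) ok (route m e t) (c.p 0) (c.p m) := by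
    refine Transfers.append (y := c.p 0) ?_ (Transfers.flatMap_finRange c.p hblock)
    rw [List.map_eq_flatMap]
    refine Transfers.flatMap_const fun j _ =>
      .cons (y := c.p 0) (fun _ => ?_) (fun hv => ?_) (.nil _)
    · simpa [subst] using c.ev_mul_p (⟨0, hm⟩, false) ⟨0, hm⟩
    · exact absurd trivial hv
  rw [word, lift_leftAct]
  rw [Transfers] at hroute
  rw [FreeMagma.lift_of]
  change List.foldl _ (c.p 0) _ = 0 ↔ _
  rw [hroute]
  have hall : (∀ v ∈ route m e t, ok v) ↔ g = Prod.fst ∧ h = Prod.fst := by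
    constructor
    · intro H
      constructor <;> funext x
      · exact H (.inl (.inr x)) (by simpa using mem_route e t (.inl (.inr x)))
      · exact H (.inr x) (by simpa using mem_route e t (.inr x))
    · rintro ⟨rfl, rfl⟩ ((_ | _) | _) _ <;> simp [ok]
  rw [← hall]
  split_ifs with H
  · exact iff_of_false c.p_ne_zero (not_not_intro H)
  · exact iff_of_true rfl H

/-- The renaming of the slot letters by a pair of permutations. -/
def rename (π ρ : Equiv.Perm (Slot m t)) : Equiv.Perm (Letter m e t) :=
  (Equiv.sumCongr (Equiv.refl _) π).sumCongr ρ

theorem subst_comp_rename (c : ModuleChain 𝒜 m) (hm : 0 < m) (g h : Slot m t → Fin m × Bool)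
    (π ρ : Equiv.Perm (Slot m t)) :
    c.subst e t hm g h ∘ rename e t π ρ = c.subst e t hm (g ∘ π) (h ∘ ρ) := by
  funext v
  rcases v with ((_ | (_ | _)) | _) | _ <;> rfl

variable [IsScalarTower F A A] [SMulCommClass F A A]

/-- For each assignment `g` in the orbit a permutation straightening `g` to `Prod.fst` renames the
word. The word of one pair of assignments then survives the substitution of another pair only if the
pairs agree. -/
theorem card_orbit_sq_le (c : ModuleChain 𝒜 m) [Module.Finite F A] (hm : 0 < m) :
    Nat.card (MulAction.orbit (Equiv.Perm (Slot m t))ᵈᵐᵃ (Prod.fst : Slot m t → Fin m × Bool)) ^ 2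
      ≤ partialCodim 𝒜 (1 + e + 2 * m + 2 * m * t) (2 * m * t) := by
  classical
  set O := MulAction.orbit (Equiv.Perm (Slot m t))ᵈᵐᵃ (Prod.fst : Slot m t → Fin m × Bool)
  have hex : ∀ g : O, ∃ π : Equiv.Perm (Slot m t), g.1 ∘ π = Prod.fst := by
    rintro ⟨_, π, rfl⟩
    refine ⟨(DomMulAct.mk.symm π)⁻¹, ?_⟩
    funext x
    change (((DomMulAct.mk.symm π) ((DomMulAct.mk.symm π)⁻¹ x))).1 = _
    rw [← Equiv.Perm.mul_apply, mul_inv_cancel, Equiv.Perm.one_apply]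
  choose π hπ using hex
  have key : ∀ g g' : O, g'.1 ∘ π g = Prod.fst ↔ g = g' := by
    intro g g'
    rw [← hπ g, (π g).surjective.injective_comp_right.eq_iff]
    exact ⟨fun h => Subtype.ext h.symm, fun h => h ▸ rfl⟩
  have main := card_le_partialCodim 𝒜 (I := O × O)
    (fun i => FreeMagma.map (rename e t (π i.1) (π i.2)) (word m e t))
    (fun i => by
      rw [leaves_map, leaves_word]
      exact congrArg Finset.val (Finset.map_univ_equiv (rename e t (π i.1) (π i.2))))
    (fun i => c.subst e t hm i.1.1 i.2.1)
    (fun i v => by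
      rcases v with (_ | (_ | _)) | _
      · exact c.p_mem
      · exact c.ev_mem _
      · exact c.conn_mem _
      · exact c.ev_mem _)
    (fun i v => c.od_mem _)
    (fun i j => by
      rw [lift_map, subst_comp_rename, lift_subst_word, key, key, ne_eq, Prod.ext_iff])
  rw [Fintype.card_prod, ← sq, ← Nat.card_eq_fintype_card] at main
  convert main using 2
  · simp only [Fintype.card_sum, Fintype.card_option, Fintype.card_prod, Fintype.card_fin,
      Fintype.card_bool]
    ring
  · simp only [Fintype.card_prod, Fintype.card_fin, Fintype.card_bool]
    ring

theorem factorial_le_gradedCodim (c : ModuleChain 𝒜 m) [Module.Finite F A] (hm : 0 < m) :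
    (4 * m * t).factorial ≤
      gradedCodim 𝒜 (4 * m * t + (1 + e + 2 * m)) * t.factorial ^ (4 * m) := by
  set a := Nat.card (MulAction.orbit (Equiv.Perm (Slot m t))ᵈᵐᵃ
    (Prod.fst : Slot m t → Fin m × Bool)) with ha
  have h1 : a * t.factorial ^ (2 * m) = (2 * m * t).factorial := by
    have := card_orbit_fst_mul (Fin m × Bool) t
    have hcard : Fintype.card (Fin m × Bool) = 2 * m := by simp [mul_comm]
    rwa [hcard] at this
  set k := 1 + e + 2 * m + 2 * m * t with hk
  set n := 4 * m * t + (1 + e + 2 * m) with hn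
  have hn2 : n = k + 2 * m * t := by rw [hn, hk]; ring
  have hnk : n - k = 2 * m * t := by omega
  have h2 : n.choose k * a ^ 2 ≤ gradedCodim 𝒜 n := by
    refine (Nat.mul_le_mul_left _ ((c.card_orbit_sq_le e t hm).trans_eq ?_)).trans
      (Finset.single_le_sum (f := fun k => n.choose k * partialCodim 𝒜 k (n - k))
        (fun _ _ => Nat.zero_le _) (Finset.mem_range.mpr (show k < n + 1 by omega)))
    rw [hnk]
  -- By symmetry `n.choose k = n.choose (2mt)`, which is monotone in `n`.
  have h3 : (4 * m * t).choose (2 * m * t) ≤ n.choose k := by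
    rw [hn2, Nat.choose_symm_add, ← hn2]
    exact Nat.choose_le_choose _ (by omega)
  have h4 : (4 * m * t).choose (2 * m * t) * (2 * m * t).factorial * (2 * m * t).factorial =
      (4 * m * t).factorial := by
    have e1 : 4 * m * t = 2 * m * t + 2 * m * t := by ring
    rw [e1, Nat.add_choose_mul_factorial_mul_factorial]
  calc (4 * m * t).factorial
      = (4 * m * t).choose (2 * m * t) * a ^ 2 * t.factorial ^ (4 * m) := by
        rw [← h4, ← h1]; ring
    _ ≤ n.choose k * a ^ 2 * t.factorial ^ (4 * m) := by gcongr
    _ ≤ _ := Nat.mul_le_mul_right _ h2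

theorem le_lowerGradedExponent (c : ModuleChain 𝒜 m) [Module.Finite F A] (hm : 0 < m) :
    (4 * m : ℝ) ≤ lowerGradedExponent 𝒜 := by
  have := le_liminf_root_of_pow_le (gradedCodim 𝒜) (4 * m) ((4 * m) ^ (1 + 2 * m + 4 * m))
    (4 * m) (Module.finrank F A) (1 + 2 * m + 4 * m) (gradedCodim_le 𝒜) ?_
  · exact_mod_cast this
  intro n hn
  -- Besides the `4mt` slot letters there are one initial, `2m` connecting and `e` filler letters.
  -- The threshold `1 + 2m + 4m` exceeds what is possible with `t = 0`.
  obtain ⟨t, e, he, rfl⟩ : ∃ t e, e < 4 * m ∧ n = 4 * m * t + (1 + e + 2 * m) := by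
    refine ⟨(n - (1 + 2 * m)) / (4 * m), (n - (1 + 2 * m)) % (4 * m),
      Nat.mod_lt _ (by omega), ?_⟩
    have := Nat.div_add_mod (n - (1 + 2 * m)) (4 * m)
    omega
  have ht : 1 ≤ t := by
    by_contra h0
    obtain rfl : t = 0 := by omega
    simp at hn
    omega
  have h1 := pow_mul_factorial_pow_le (4 * m) ht
  have h2 := c.factorial_le_gradedCodim e t hm
  set n := 4 * m * t + (1 + e + 2 * m) with hn'
  have h3 : (4 * m) ^ (4 * m * t) ≤ gradedCodim 𝒜 n * n ^ (4 * m) := by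
    refine Nat.le_of_mul_le_mul_right (c := t.factorial ^ (4 * m)) ?_
      (pow_pos t.factorial_pos _)
    calc _ ≤ (4 * m * t).factorial * (4 * m * t) ^ (4 * m) := h1
      _ ≤ (gradedCodim 𝒜 n * t.factorial ^ (4 * m)) * n ^ (4 * m) := by
        gcongr
        omega
      _ = _ := by ring
  calc (4 * m) ^ n = (4 * m) ^ (1 + e + 2 * m) * (4 * m) ^ (4 * m * t) := by
        rw [hn', pow_add, mul_comm]
    _ ≤ (4 * m) ^ (1 + 2 * m + 4 * m) * (gradedCodim 𝒜 n * n ^ (4 * m)) :=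
        Nat.mul_le_mul (Nat.pow_le_pow_right (by omega) (by omega)) h3
    _ = _ := by ring

end ModuleChain

end GradedPI

/-! ### Products of homogeneous elements of the superalgebra. -/

namespace SuperInv

variable {F R : Type*} [Field F] [Ring R] [Algebra F R]

namespace SuperAlg

/-- The even element with upper left entry `x`. -/
def diag (σ : Involution F R) : R →ₗ[F] SuperAlg σ where
  toFun x := ⟨!![x, 0; 0, -σ.toLin x], by simp [superSpace]⟩
  map_add' x y := by
    apply Subtype.ext
    change !![x + y, 0; 0, -σ.toLin (x + y)] = !![x, 0; 0, -σ.toLin (x)] + !![y, 0; 0, -σ.toLin (y)]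
    ext i j
    fin_cases i <;> fin_cases j <;> simp
    abel
  map_smul' c x := by
    apply Subtype.ext
    change !![c • x, 0; 0, -σ.toLin (c • x)] = c • !![x, 0; 0, -σ.toLin (x)]
    ext i j
    fin_cases i <;> fin_cases j <;> simp

/-- The odd element with upper right entry `w + w*`. -/
def upper (σ : Involution F R) : R →ₗ[F] SuperAlg σ where
  toFun w := ⟨!![0, w + σ.toLin w; 0, 0], by simp [superSpace, σ.invol, add_comm]⟩
  map_add' x y := by
    apply Subtype.ext
    change !![0, x + y + σ.toLin (x + y); 0, 0] = !![0, x + σ.toLin (x); 0, 0] + !![0, y + σ.toLin (y); 0, 0]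
    ext i j
    fin_cases i <;> fin_cases j <;> simp
    abel
  map_smul' c x := by
    apply Subtype.ext
    change !![0, c • x + σ.toLin (c • x); 0, 0] = c • !![0, x + σ.toLin (x); 0, 0]
    ext i j
    fin_cases i <;> fin_cases j <;> simp

/-- The odd element with lower left entry `w - w*`. -/
def lower (σ : Involution F R) : R →ₗ[F] SuperAlg σ where
  toFun w := ⟨!![0, 0; w - σ.toLin w, 0], by simp [superSpace, σ.invol]⟩
  map_add' x y := by
    apply Subtype.ext
    change !![0, 0; x + y - σ.toLin (x + y), 0] = !![0, 0; x - σ.toLin (x), 0] + !![0, 0; y - σ.toLin (y), 0]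
    ext i j
    fin_cases i <;> fin_cases j <;> simp
    abel
  map_smul' c x := by
    apply Subtype.ext
    change !![0, 0; c • x - σ.toLin (c • x), 0] = c • !![0, 0; x - σ.toLin (x), 0]
    ext i j
    fin_cases i <;> fin_cases j <;> simp [smul_sub]

variable {σ : Involution F R}

theorem toMatrix_diag (x : R) : toMatrix (diag σ x) = !![x, 0; 0, -σ.toLin x] := rfl

theorem toMatrix_upper (w : R) : toMatrix (upper σ w) = !![0, w + σ.toLin w; 0, 0] := rfl

theorem toMatrix_lower (w : R) : toMatrix (lower σ w) = !![0, 0; w - σ.toLin w, 0] := rfl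

theorem diag_mem (x : R) : diag σ x ∈ grading σ 0 := by
  simp [grading, toMatrix_diag]

theorem upper_mem (x : R) : upper σ x ∈ grading σ 1 := by
  simp [grading, toMatrix_upper]

theorem lower_mem (x : R) : lower σ x ∈ grading σ 1 := by
  simp [grading, toMatrix_lower]

theorem diag_injective : Function.Injective (diag σ) := fun x y h => by
  simpa [toMatrix_diag] using congrFun (congrFun (congrArg toMatrix h) 0) 0

theorem diag_mul_diag (x y : R) : diag σ x * diag σ y = diag σ (x * y - y * x) := by
  apply toMatrix_injective
  simp only [toMatrix_mul, superBracket_eq, toMatrix_diag, map_sub, σ.map_mul]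
  ext i j
  fin_cases i <;> fin_cases j <;> simp
  abel

theorem diag_mul_upper (x w : R) :
    diag σ x * upper σ w = upper σ (x * (w + σ.toLin w)) := by
  apply toMatrix_injective
  simp only [toMatrix_mul, superBracket_eq, toMatrix_diag, toMatrix_upper, σ.map_mul, map_add,
    σ.invol]
  ext i j
  fin_cases i <;> fin_cases j <;> simp
  noncomm_ring

theorem diag_mul_lower (x w : R) :
    diag σ x * lower σ w = lower σ (-(σ.toLin x * (w - σ.toLin w))) := by
  apply toMatrix_injective
  simp only [toMatrix_mul, superBracket_eq, toMatrix_diag, toMatrix_lower, σ.map_mul, map_sub,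
    map_neg, σ.invol]
  ext i j
  fin_cases i <;> fin_cases j <;> simp
  noncomm_ring

theorem upper_mul_diag (x w : R) :
    upper σ w * diag σ x = upper σ (-(x * (w + σ.toLin w))) := by
  apply toMatrix_injective
  simp only [toMatrix_mul, superBracket_eq, toMatrix_diag, toMatrix_upper, σ.map_mul, map_add,
    map_neg, σ.invol]
  ext i j
  fin_cases i <;> fin_cases j <;> simp
  noncomm_ring

theorem lower_mul_diag (x w : R) :
    lower σ w * diag σ x = lower σ (σ.toLin x * (w - σ.toLin w)) := by
  apply toMatrix_injective
  simp only [toMatrix_mul, superBracket_eq, toMatrix_diag, toMatrix_lower, σ.map_mul, map_sub,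
    σ.invol]
  ext i j
  fin_cases i <;> fin_cases j <;> simp
  noncomm_ring

theorem upper_mul_lower (w v : R) :
    upper σ w * lower σ v = diag σ ((w + σ.toLin w) * (v - σ.toLin v)) := by
  apply toMatrix_injective
  simp only [toMatrix_mul, superBracket_eq, toMatrix_diag, toMatrix_lower, toMatrix_upper,
    σ.map_mul, map_sub, map_add, σ.invol]
  ext i j
  fin_cases i <;> fin_cases j <;> simp
  noncomm_ring

theorem lower_mul_upper (w v : R) :
    lower σ v * upper σ w = diag σ ((w + σ.toLin w) * (v - σ.toLin v)) := by
  apply toMatrix_injective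
  simp only [toMatrix_mul, superBracket_eq, toMatrix_diag, toMatrix_lower, toMatrix_upper,
    σ.map_mul, map_sub, map_add, σ.invol]
  ext i j
  fin_cases i <;> fin_cases j <;> simp
  noncomm_ring

theorem upper_mul_upper (w v : R) : upper σ w * upper σ v = 0 := by
  apply toMatrix_injective
  simp only [toMatrix_mul, superBracket_eq, toMatrix_upper, map_zero]
  ext i j
  fin_cases i <;> fin_cases j <;> simp

theorem lower_mul_lower (w v : R) : lower σ w * lower σ v = 0 := by
  apply toMatrix_injective
  simp only [toMatrix_mul, superBracket_eq, toMatrix_lower, map_zero]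
  ext i j
  fin_cases i <;> fin_cases j <;> simp

/-- This and `lower_eq_zero` make the odd unit that leads from `q` to `p` annihilate `p`. -/
theorem upper_eq_zero {w : R} (h : σ.toLin w = -w) : upper σ w = 0 := by
  apply toMatrix_injective
  rw [toMatrix_upper, h]
  ext i j
  fin_cases i <;> fin_cases j <;> simp

theorem lower_eq_zero {w : R} (h : σ.toLin w = w) : lower σ w = 0 := by
  apply toMatrix_injective
  rw [toMatrix_lower, h]
  ext i j
  fin_cases i <;> fin_cases j <;> simp

instance [Module.Finite F R] : Module.Finite F (SuperAlg σ) :=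
  inferInstanceAs (Module.Finite F (superSpace σ))

end SuperAlg

/-! ### From Peirce components to chains of modules. -/

/-- Elements `e l` and nonzero elements `u l` of `e l * R * (e l)*` with `u (l + 1)` obtained from
`u l` by multiplication on both sides. -/
structure PeirceChain (σ : Involution F R) (m : ℕ) where
  /-- the elements `e l` -/
  e : Fin m → R
  /-- the off-diagonal elements -/
  u : ℕ → R
  /-- the left connecting elements -/
  k : Fin m → R
  /-- the right connecting elements -/
  k' : Fin m → R
  e_mul : ∀ i (l : Fin m), e i * u l = if i = l then u l else 0
  mul_e : ∀ i (l : Fin m), u l * e i = 0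
  star_mul : ∀ i (l : Fin m), σ.toLin (e i) * u l = 0
  mul_star : ∀ i (l : Fin m), u l * σ.toLin (e i) = if i = l then u l else 0
  u_mul_k : ∀ l : Fin m, u l * k l = 0
  k'_mul_k : ∀ l, k' l * k l = 0
  k_mul_u_mul_k' : ∀ l : Fin m, k l * u l * k' l = u (l + 1)
  u_ne_zero : u m ≠ 0

namespace PeirceChain

open SuperAlg

variable {σ : Involution F R} {m : ℕ} (c : PeirceChain σ m)

/-- The chain of modules for symmetric `u`. -/
def moduleChainOfSymm [CharZero F] (hu : ∀ l, σ.toLin (c.u l) = c.u l) :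
    GradedPI.ModuleChain (grading σ) m where
  p l := diag σ (c.u l)
  q l := upper σ (c.u l)
  ev
    | (i, false) => diag σ (-σ.toLin (c.e i))
    -- On `p` the contributions of `e` and `e*` cancel in the commutator. The `1 / 2` compensates
    -- for the corner `u + u* = 2u` of `q`.
    | (i, true) => diag σ ((1 / 2 : F) • (c.e i + σ.toLin (c.e i)))
  od
    | (i, false) => upper σ (-c.e i)
    | (i, true) => lower σ (-(1 / 2 : F) • c.e i)
  conn
    | (i, false) => diag σ (c.k i)
    | (i, true) => diag σ (-c.k' i)
  p_mem := diag_mem _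
  ev_mem := by rintro ⟨i, _ | _⟩ <;> exact diag_mem _
  od_mem := by
    rintro ⟨i, _ | _⟩
    · exact upper_mem _
    · exact lower_mem _
  conn_mem := by rintro ⟨i, _ | _⟩ <;> exact diag_mem _
  ev_mul_p := by
    rintro ⟨i, _ | _⟩ l <;> by_cases h : i = l <;>
      simp [smul_mul_assoc, diag_mul_diag, h, c.e_mul, c.mul_e, c.star_mul, c.mul_star, add_mul]
  ev_mul_q := by
    rintro ⟨i, _ | _⟩ l <;> by_cases h : i = l <;>
      simp [smul_mul_assoc, diag_mul_upper, h, hu, c.e_mul, c.star_mul, add_mul, mul_add]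
    module
  od_mul_p := by
    rintro ⟨i, _ | _⟩ l <;> by_cases h : i = l <;>
      simp [smul_mul_assoc, upper_mul_diag, lower_mul_diag, h, hu, c.mul_e, c.mul_star, mul_add, mul_sub,
        lower_eq_zero]
  od_mul_q := by
    rintro ⟨i, _ | _⟩ l <;> by_cases h : i = l <;>
      simp [smul_mul_assoc, upper_mul_upper, lower_mul_upper, h, hu, c.mul_e, c.mul_star, add_mul, mul_sub]
    module
  -- As `u k = 0` and `k' k = 0`, the two commutators reduce to multiplying by `k` on the left and
  -- by `k'` on the right.
  conn_mul l := by
    simp [diag_mul_diag, ← mul_assoc, c.u_mul_k, c.k'_mul_k, c.k_mul_u_mul_k']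
  p_ne_zero := by simpa using (diag_injective (σ := σ)).ne c.u_ne_zero

/-- The chain of modules for skew-symmetric `u`. -/
def moduleChainOfSkew [CharZero F] (hu : ∀ l, σ.toLin (c.u l) = -c.u l) :
    GradedPI.ModuleChain (grading σ) m where
  p l := diag σ (c.u l)
  q l := lower σ (c.u l)
  ev
    | (i, false) => diag σ (c.e i)
    | (i, true) => diag σ (-(1 / 2 : F) • (c.e i + σ.toLin (c.e i)))
  od
    | (i, false) => lower σ (c.e i)
    | (i, true) => upper σ ((1 / 2 : F) • c.e i)
  conn
    | (i, false) => diag σ (c.k i)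
    | (i, true) => diag σ (-c.k' i)
  p_mem := diag_mem _
  ev_mem := by rintro ⟨i, _ | _⟩ <;> exact diag_mem _
  od_mem := by
    rintro ⟨i, _ | _⟩
    · exact lower_mem _
    · exact upper_mem _
  conn_mem := by rintro ⟨i, _ | _⟩ <;> exact diag_mem _
  ev_mul_p := by
    rintro ⟨i, _ | _⟩ l <;> by_cases h : i = l <;>
      simp [smul_mul_assoc, diag_mul_diag, h, c.e_mul, c.mul_e, c.star_mul, c.mul_star, add_mul]
  ev_mul_q := by
    rintro ⟨i, _ | _⟩ l <;> by_cases h : i = l <;>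
      simp [smul_mul_assoc, diag_mul_lower, h, hu, σ.invol, c.e_mul, c.star_mul, add_mul, mul_add]
    module
  od_mul_p := by
    rintro ⟨i, _ | _⟩ l <;> by_cases h : i = l <;>
      simp [smul_mul_assoc, upper_mul_diag, lower_mul_diag, h, hu, c.mul_e, c.mul_star, mul_add, mul_sub,
        upper_eq_zero]
  od_mul_q := by
    rintro ⟨i, _ | _⟩ l <;> by_cases h : i = l <;>
      simp [smul_mul_assoc, lower_mul_lower, upper_mul_lower, h, hu, c.e_mul, c.star_mul, add_mul, mul_add]
    module
  conn_mul l := by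
    simp [diag_mul_diag, ← mul_assoc, c.u_mul_k, c.k'_mul_k, c.k_mul_u_mul_k']
  p_ne_zero := by simpa using (diag_injective (σ := σ)).ne c.u_ne_zero

end PeirceChain

section UpperTriangular

variable (F)

/-- The matrix unit `e_{ij}`, `i ≤ j`, as an upper triangular matrix. -/
def unit {t : ℕ} {i j : Fin t} (h : i ≤ j) : UT F t :=
  ⟨Matrix.single i j 1, fun a b hab => by
    rw [Matrix.single_apply, if_neg]
    rintro ⟨rfl, rfl⟩
    exact absurd hab (not_lt.mpr h)⟩

variable {F}

theorem coe_unit {t : ℕ} {i j : Fin t} (h : i ≤ j) :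
    (unit F h : Matrix (Fin t) (Fin t) F) = Matrix.single i j 1 := rfl

theorem unit_mul_unit {t : ℕ} {i j k l : Fin t} (h : i ≤ j) (h' : k ≤ l) :
    unit F h * unit F h' = if hjk : j = k then unit F (h.trans (hjk.trans_le h')) else 0 := by
  apply Subtype.ext
  by_cases hjk : j = k
  · subst hjk
    simp [coe_unit]
  · simp [coe_unit, hjk, Matrix.single_mul_single_of_ne]

theorem unit_mul_unit_same {t : ℕ} {i j l : Fin t} (h : i ≤ j) (h' : j ≤ l) :
    unit F h * unit F h' = unit F (h.trans h') := by
  rw [unit_mul_unit, dif_pos rfl]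

theorem unit_mul_unit_of_ne {t : ℕ} {i j k l : Fin t} (h : i ≤ j) (h' : k ≤ l) (hjk : j ≠ k) :
    unit F h * unit F h' = 0 := by
  rw [unit_mul_unit, dif_neg hjk]

theorem unit_ne_zero {t : ℕ} {i j : Fin t} (h : i ≤ j) : unit F h ≠ 0 := fun h0 => by
  have := congrFun (congrFun (congrArg Subtype.val h0) i) j
  simp [coe_unit] at this

theorem orthogonal_unit {t : ℕ} {i j : Fin t} (h : i ≤ j) :
    (orthogonal F t).toLin (unit F h) = unit F (Fin.rev_le_rev.mpr h) := by
  apply Subtype.ext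
  change reflect (Matrix.single i j 1) = Matrix.single j.rev i.rev 1
  ext a b
  simp only [reflect, Matrix.of_apply, Matrix.single_apply, Fin.rev_eq_iff]
  simp only [and_comm]

theorem coe_symplectic (m : ℕ) (X : UT F (2 * m)) (i j : Fin (2 * m)) :
    ((symplectic F m).toLin X : Matrix _ _ F) i j =
      (if (i : ℕ) < m then 1 else -1) * ((orthogonal F (2 * m)).toLin X : Matrix _ _ F) i j *
        (if (j : ℕ) < m then 1 else -1) := by
  change (signMatrix F m * reflect X.1 * (signMatrix F m)⁻¹) i j = _
  rw [signMatrix_inv, signMatrix, Matrix.mul_diagonal, Matrix.diagonal_mul]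
  rfl

theorem symplectic_unit {m : ℕ} {i j : Fin (2 * m)} (h : i ≤ j) :
    (symplectic F m).toLin (unit F h) =
      ((if (j.rev : ℕ) < m then 1 else -1) * (if (i.rev : ℕ) < m then 1 else -1) : F) •
        unit F (Fin.rev_le_rev.mpr h) := by
  apply Subtype.ext
  ext a b
  rw [coe_symplectic, orthogonal_unit]
  simp only [coe_unit, SetLike.val_smul, Matrix.smul_apply]
  by_cases hab : j.rev = a ∧ i.rev = b
  · obtain ⟨rfl, rfl⟩ := hab
    simp
  · rw [Matrix.single_apply, if_neg hab]
    simp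

variable {m : ℕ}

/-- The row index of the `l`-th stage: the rows `m, m - 1, …, 1` (counted from `1`), the last one
being repeated. -/
def row (hm : 1 ≤ m) (l : ℕ) : Fin (2 * m) := ⟨m - 1 - l, by omega⟩

theorem row_ne_rev (hm : 1 ≤ m) (l l' : ℕ) : row hm l ≠ (row hm l').rev := by
  simp only [row, ne_eq, Fin.ext_iff, Fin.val_rev]
  omega

theorem row_le_rev (hm : 1 ≤ m) (l : ℕ) : row hm l ≤ (row hm l).rev := by
  simp only [row, Fin.le_def, Fin.val_rev]
  omega

theorem row_succ_le (hm : 1 ≤ m) (l : ℕ) : row hm (l + 1) ≤ row hm l := by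
  simp only [row, Fin.le_def]
  omega

theorem row_inj (hm : 1 ≤ m) {i l : Fin m} : row hm i = row hm l ↔ i = l := by
  simp only [row, Fin.ext_iff]
  omega

/-- The chain `e_{m,m+1}, e_{m-1,m+2}, …, e_{1,2m}` of upper triangular matrix units. -/
def unitChain (hm : 1 ≤ m) (σ : Involution F (UT F (2 * m)))
    (hσ : ∀ i : Fin (2 * m), σ.toLin (unit F (le_refl i)) = unit F (le_refl i.rev)) :
    PeirceChain σ m where
  e i := unit F (le_refl (row hm i))
  u l := unit F (row_le_rev hm l)
  k l := unit F (row_succ_le hm l)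
  k' l := unit F (Fin.rev_le_rev.mpr (row_succ_le hm l))
  e_mul i l := by
    by_cases h : i = l
    · subst h
      rw [unit_mul_unit_same, if_pos rfl]
    · rw [unit_mul_unit_of_ne _ _ fun h' => h ((row_inj hm).mp h'), if_neg h]
  mul_e i l := unit_mul_unit_of_ne _ _ (row_ne_rev hm _ _).symm
  star_mul i l := by
    rw [hσ, unit_mul_unit_of_ne _ _ (row_ne_rev hm _ _).symm]
  mul_star i l := by
    rw [hσ]
    by_cases h : i = l
    · subst h
      rw [unit_mul_unit_same, if_pos rfl]
    · rw [unit_mul_unit_of_ne _ _ fun h' => h ((row_inj hm).mp (Fin.rev_injective h').symm),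
        if_neg h]
  u_mul_k l := unit_mul_unit_of_ne _ _ (row_ne_rev hm _ _).symm
  k'_mul_k l := unit_mul_unit_of_ne _ _ (row_ne_rev hm _ _).symm
  k_mul_u_mul_k' l := by rw [unit_mul_unit_same, unit_mul_unit_same]
  u_ne_zero := unit_ne_zero _

end UpperTriangular

end SuperInv

end

theorem lemma5 (F : Type*) [Field F] [CharZero F] (m : ℕ) (hm : 1 ≤ m)
    (σ : SuperInv.Involution F (SuperInv.UT F (2 * m)))
    (hσ : σ = SuperInv.orthogonal F (2 * m) ∨ σ = SuperInv.symplectic F m) :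
    (4 * m : ℝ) ≤ GradedPI.lowerGradedExponent (SuperInv.grading σ) := by
  have : Module.Finite F (SuperInv.UT F (2 * m)) :=
    inferInstanceAs (Module.Finite F (Subalgebra.toSubmodule (SuperInv.UT F (2 * m))))
  rcases hσ with rfl | rfl
  · refine ((SuperInv.unitChain hm _ fun i => ?_).moduleChainOfSymm
      fun l => ?_).le_lowerGradedExponent hm
    · exact SuperInv.orthogonal_unit _
    · simp only [SuperInv.unitChain, SuperInv.orthogonal_unit, Fin.rev_rev]
  · refine ((SuperInv.unitChain hm _ fun i => ?_).moduleChainOfSkew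
      fun l => ?_).le_lowerGradedExponent hm
    · rw [SuperInv.symplectic_unit]
      split_ifs <;> simp
    · simp only [SuperInv.unitChain, SuperInv.symplectic_unit, Fin.rev_rev]
      have h1 : (SuperInv.row hm l : ℕ) < m := by simp only [SuperInv.row]; omega
      have h2 : ¬ ((SuperInv.row hm l).rev : ℕ) < m := by rw [Fin.val_rev]; omega
      rw [if_pos h1, if_neg h2]
      simp
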